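/- For a commutative ring $A$ let $\mathrm{Q}(A)$ be its total ring of fractions and $\overline{A}$ the integral closure of $A$ in $\mathrm{Q}(A)$. For a ring extension $B/A$, the strict closure of $A$ in $B$ is $\{\alpha\in B \mid \alpha\otimes 1=1\otimes\alpha \text{ in } B\otimes_A B\}$, and $A$ is called strictly closed if it equals its strict closure in $\overline{A}$. Let $F$ be any field of characteristic $3$, let $K=\mathrm{Q}(F[t])=F(t)$ be the rational function field, and let $k=\mathrm{Q}(F[t^3])=F(t^3)\subseteq K$. Let $R=k[X,tX,t^2X]$, the $k$-subalgebra of the polynomial ring $K[X]$ generated by $X$, $tX$ and $t^2X$. Then: 1. $K=k[t]$, and $\{1,t,t^2\}$ is a $k$-basis of $K$. 2. $R$ is strictly closed, but $K\otimes_k R$ is not strictly closed. 3. $R$ and $K\otimes_k R$ are Noetherian, the canonical homomorphism $R\to K\otimes_k R$ is faithfully flat, $R$ is reduced, and $\overline{R}$ is a finitely generated $R$-module. In particular, for a faithfully flat homomorphism $R\to S$ of Noetherian rings with $R$ reduced and $\overline{R}$ finitely generated over $R$, strict closedness of $R$ does not imply strict closedness of $S$ without a further hypothesis (such as regularity of the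 fibres). -/

import Mathlib

open scoped Polynomial TensorProduct

universe u v

/-- The strict closure of `R` in an `R`-algebra `S`: the elements `α` of `S` such that
`α ⊗ 1 = 1 ⊗ α` in `S ⊗[R] S`. It is an `R`-subalgebra of `S`. -/
def strictClosure (R : Type u) (S : Type v) [CommRing R] [CommRing S] [Algebra R S] :
    Subalgebra R S where
  carrier := {α | α ⊗ₜ[R] (1 : S) = (1 : S) ⊗ₜ[R] α}
  mul_mem' {a b} ha hb := by
    have h : (a ⊗ₜ[R] (1 : S)) * (b ⊗ₜ[R] (1 : S)) = ((1 : S) ⊗ₜ[R] a) * ((1 : S) ⊗ₜ[R] b) := by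
      rw [show a ⊗ₜ[R] (1 : S) = (1 : S) ⊗ₜ[R] a from ha,
        show b ⊗ₜ[R] (1 : S) = (1 : S) ⊗ₜ[R] b from hb]
    simpa using h
  add_mem' {a b} ha hb := by
    change (a + b) ⊗ₜ[R] (1 : S) = (1 : S) ⊗ₜ[R] (a + b)
    rw [TensorProduct.add_tmul, TensorProduct.tmul_add,
      show a ⊗ₜ[R] (1 : S) = (1 : S) ⊗ₜ[R] a from ha,
      show b ⊗ₜ[R] (1 : S) = (1 : S) ⊗ₜ[R] b from hb]
  algebraMap_mem' r := by
    change (algebraMap R S r) ⊗ₜ[R] (1 : S) = (1 : S) ⊗ₜ[R] (algebraMap R S r)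
    rw [Algebra.algebraMap_eq_smul_one, TensorProduct.smul_tmul]

/-- `R` is strictly closed in `S` if its strict closure in `S` is (the image of) `R` itself. -/
def IsStrictlyClosedIn (R : Type u) (S : Type v) [CommRing R] [CommRing S] [Algebra R S] : Prop :=
  strictClosure R S = ⊥

/-- The integral closure of `R` in its total ring of fractions `FractionRing R`, the localization
of `R` at the set of all its non-zerodivisors. -/
abbrev totalIntegralClosure (R : Type u) [CommRing R] : Subalgebra R (FractionRing R) :=
  integralClosure R (FractionRing R)

/-- `R` is strictly closed if it is strictly closed in its integral closure in its total ring of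
fractions. -/
def IsStrictlyClosed (R : Type u) [CommRing R] : Prop :=
  IsStrictlyClosedIn R (totalIntegralClosure R)

section Construction

variable (F : Type u) [Field F]

/-- The subfield `k = Q(F[t³])` of the rational function field `K = RatFunc F = Q(F[t])`,
i.e. the field of fractions, inside `K`, of the subring `F[t³]`. -/
noncomputable abbrev cubeSubfield : IntermediateField F (RatFunc F) :=
  IntermediateField.adjoin F {(RatFunc.X : RatFunc F) ^ 3}

/-- The `k`-subalgebra `k[X, tX, t²X]` of the polynomial ring `K[X]`. -/
noncomputable def cubeRing : Subalgebra (cubeSubfield F) (RatFunc F)[X] :=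
  Algebra.adjoin (cubeSubfield F)
    {Polynomial.X,
      Polynomial.C (RatFunc.X : RatFunc F) * Polynomial.X,
      Polynomial.C ((RatFunc.X : RatFunc F) ^ 2) * Polynomial.X}

end Construction

/-!
Over `k = F(t³)`, the monomials `X`, `tX`, `t²X` generate `R = k + X K[X]`, because `1, t, t²` span
`K = F(t)`. The integral closure of `R` is `K[X]`, and taking constant coefficients sends the strict
closure of `R` in `K[X]` into that of `k` in `K`, which is `k` by faithfully flat descent.

The base change `K ⊗ R` is of the same shape, namely `K + X (K ⊗ K)[X]`, but `K ⊗ K` contains the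
nilpotent `τ = 1 ⊗ t - t ⊗ 1`. Hence `τX` is nilpotent, so the fraction `τX / X²` is integral, and
strict closedness would force `X²` to divide `(τX)²` in `K + X (K ⊗ K)[X]`, that is, `τ² ∈ K`. This
contradicts the independence of `1, t, t²` over `k`.
-/

section StrictClosure

variable {R S R' S' : Type*} [CommRing R] [CommRing S] [CommRing R'] [CommRing S']
  [Algebra R S] [Algebra R' S']

theorem map_mem_strictClosure (f : S →+* S')
    (hf : ∀ r, f (algebraMap R S r) ∈ (⊥ : Subalgebra R' S')) {s : S}
    (hs : s ∈ strictClosure R S) : f s ∈ strictClosure R' S' := by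
  have hbot : ⊥ ≤ strictClosure R' S' := bot_le
  let : Algebra R (S' ⊗[R'] S') :=
    (Algebra.TensorProduct.includeLeftRingHom.comp (f.comp (algebraMap R S))).toAlgebra
  let inl : S →ₐ[R] S' ⊗[R'] S' :=
    { Algebra.TensorProduct.includeLeftRingHom.comp f with commutes' := fun _ ↦ rfl }
  let inr : S →ₐ[R] S' ⊗[R'] S' :=
    { Algebra.TensorProduct.includeRight.toRingHom.comp f with
      commutes' := fun r ↦ (hbot (hf r)).symm }
  have h := congrArg (Algebra.TensorProduct.lift inl inr fun _ _ ↦ Commute.all _ _)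
    (show s ⊗ₜ[R] (1 : S) = (1 : S) ⊗ₜ[R] s from hs)
  simp only [Algebra.TensorProduct.lift_tmul, map_one, one_mul, mul_one] at h
  exact h

theorem isStrictlyClosedIn_iff_isEffective :
    IsStrictlyClosedIn R S ↔ Algebra.IsEffective R S := by
  simp only [IsStrictlyClosedIn, Algebra.IsEffective, Function.Exact, SetLike.ext_iff,
    Algebra.mem_bot, Algebra.coe_linearMap, Algebra.TensorProduct.includeLeftSubRight_apply,
    sub_eq_zero]
  rfl

theorem IsStrictlyClosedIn.of_faithfullyFlat [Module.FaithfullyFlat R S] :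
    IsStrictlyClosedIn R S :=
  isStrictlyClosedIn_iff_isEffective.2 (.of_faithfullyFlat R S)

theorem IsStrictlyClosedIn.of_algEquiv {T : Type*} [CommRing T] [Algebra R T] (e : S ≃ₐ[R] T)
    (h : IsStrictlyClosedIn R T) : IsStrictlyClosedIn R S := by
  refine eq_bot_iff.2 fun s hs ↦ ?_
  have hes : e s ∈ (⊥ : Subalgebra R T) :=
    h ▸ map_mem_strictClosure (e : S →+* T) (fun r ↦ ⟨r, (e.commutes r).symm⟩) hs
  obtain ⟨r, hr⟩ := hes
  exact ⟨r, e.injective ((e.commutes r).trans hr)⟩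

-- `d` plays the role of the fraction `y / x`, and `y • d` that of `y² / x`.
theorem smul_mem_strictClosure_of_smul_eq {x y : R} {d : S} (h : x • d = algebraMap R S y) :
    y • d ∈ strictClosure R S := by
  rw [Algebra.algebraMap_eq_smul_one] at h
  calc (y • d) ⊗ₜ[R] (1 : S) = d ⊗ₜ[R] (y • (1 : S)) := by rw [TensorProduct.smul_tmul]
    _ = (x • d) ⊗ₜ[R] d := by rw [← h, TensorProduct.smul_tmul]
    _ = (1 : S) ⊗ₜ[R] (y • d) := by rw [h, TensorProduct.smul_tmul]

theorem IsStrictlyClosed.of_ringEquiv (e : R ≃+* R') (h : IsStrictlyClosed R') :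
    IsStrictlyClosed R := by
  let ε : FractionRing R ≃+* FractionRing R' := IsFractionRing.ringEquivOfRingEquiv e
  have hε (r : R) : ε (algebraMap R _ r) = algebraMap R' _ (e r) :=
    IsFractionRing.ringEquivOfRingEquiv_algebraMap e r
  have hint (q : totalIntegralClosure R) : ε q ∈ totalIntegralClosure R' :=
    q.2.map_of_comp_eq (e : R →+* R') (ε : FractionRing R →+* FractionRing R')
      (RingHom.ext fun r ↦ (hε r).symm)
  let f : totalIntegralClosure R →+* totalIntegralClosure R' :=
    ((ε : FractionRing R →+* FractionRing R').comp (totalIntegralClosure R).subtype).codRestrict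
      _ hint
  refine eq_bot_iff.2 fun q hq ↦ ?_
  have hfq : f q ∈ (⊥ : Subalgebra R' (totalIntegralClosure R')) :=
    h ▸ map_mem_strictClosure f (fun r ↦ ⟨e r, Subtype.ext (hε r).symm⟩) hq
  obtain ⟨r', hr'⟩ := hfq
  refine ⟨e.symm r', Subtype.ext (ε.injective ?_)⟩
  calc ε (algebraMap R _ (e.symm r')) = algebraMap R' _ r' := by rw [hε, e.apply_symm_apply]
    _ = ε q := congrArg Subtype.val hr'

theorem IsStrictlyClosed.dvd_sq_of_isIntegral (h : IsStrictlyClosed R) {x y : R}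
    {q : FractionRing R} (hq : IsIntegral R q) (hxy : x • q = algebraMap R _ y) : x ∣ y ^ 2 := by
  let d : totalIntegralClosure R := ⟨q, hq⟩
  have hd : x • d = algebraMap R _ y := Subtype.ext hxy
  have hyd : y • d ∈ (⊥ : Subalgebra R (totalIntegralClosure R)) :=
    h ▸ smul_mem_strictClosure_of_smul_eq hd
  obtain ⟨s, hs⟩ := hyd
  have hs' : algebraMap R (FractionRing R) s = y • q := congrArg Subtype.val hs
  refine ⟨s, IsFractionRing.injective R (FractionRing R) ?_⟩
  rw [map_mul, hs', ← Algebra.smul_def, smul_comm, hxy, Algebra.smul_def, ← map_mul, sq]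

theorem IsStrictlyClosed.dvd_sq_of_isNilpotent (h : IsStrictlyClosed R) {x y : R}
    (hx : x ∈ nonZeroDivisors R) (hy : IsNilpotent y) : x ∣ y ^ 2 := by
  let q : FractionRing R := IsLocalization.mk' _ y ⟨x, hx⟩
  have hq : IsNilpotent q := by
    rw [show q = _ from IsLocalization.mk'_eq_mul_mk'_one y ⟨x, hx⟩]
    exact (Commute.all _ _).isNilpotent_mul_right (hy.map (algebraMap R _))
  have hq_int : IsIntegral R q := by
    obtain ⟨n, hn⟩ := hq
    exact ⟨Polynomial.X ^ n, Polynomial.monic_X_pow n, by simp [hn]⟩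
  refine h.dvd_sq_of_isIntegral hq_int ?_
  rw [Algebra.smul_def]
  exact IsLocalization.mk'_spec' (FractionRing R) y ⟨x, hx⟩

variable (R S) in
/-- Any model `S` of the integral closure of `R` in a model `L` of its total ring of fractions is
isomorphic to `totalIntegralClosure R`. -/
noncomputable def totalIntegralClosureEquiv (L : Type*) [CommRing L] [Algebra R L]
    [IsFractionRing R L] [Algebra S L] [IsScalarTower R S L] [IsIntegralClosure S R L] :
    totalIntegralClosure R ≃ₐ[R] S :=
  (FractionRing.algEquiv R L).mapIntegralClosure.trans
    (IsIntegralClosure.equiv R (integralClosure R L) L S)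

end StrictClosure

section TensorProduct

variable {k A B : Type*} [CommRing k] [CommRing A] [CommRing B] [Algebra k A] [Algebra k B]

attribute [local instance] Algebra.TensorProduct.rightAlgebra in
theorem faithfullyFlat_includeRight [Module.FaithfullyFlat k A] :
    (Algebra.TensorProduct.includeRight : B →ₐ[k] A ⊗[k] B).toRingHom.FaithfullyFlat := by
  have : Module.FaithfullyFlat B (A ⊗[k] B) :=
    .of_linearEquiv B (B ⊗[k] A) (Algebra.TensorProduct.commRight k B A).symm.toLinearEquiv
  exact RingHom.faithfullyFlat_algebraMap_iff.2 this

variable (k A B) in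
/-- Extension of scalars commutes with forming polynomial rings: `A ⊗ B[X]` is the polynomial ring
over `A ⊗ B`, with `1 ⊗ X` corresponding to `X`. -/
noncomputable def polynomialBaseChangeEquiv : A ⊗[k] B[X] ≃ₐ[A] (A ⊗[k] B)[X] :=
  AlgEquiv.ofAlgHom
    (Algebra.TensorProduct.lift (Algebra.ofId A (A ⊗[k] B)[X])
      (Polynomial.mapAlgHom Algebra.TensorProduct.includeRight) fun _ _ ↦ Commute.all _ _)
    (Polynomial.eval₂AlgHom
      (Algebra.TensorProduct.map (AlgHom.id A A) (Polynomial.CAlgHom))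
      (1 ⊗ₜ Polynomial.X) fun _ ↦ Commute.all _ _)
    (by ext <;> simp [← Algebra.TensorProduct.one_def]) (by ext <;> simp)

end TensorProduct

section ConstantCoeff

/-- The ring `k + X K[X]` of polynomials over a `k`-algebra `K` whose constant coefficient lies in
the image of `k`. -/
noncomputable def constantCoeffSubalgebra (k K : Type*) [CommRing k] [CommRing K] [Algebra k K] :
    Subalgebra k K[X] :=
  (⊥ : Subalgebra k K).comap ((Polynomial.aeval (0 : K)).restrictScalars k)

namespace constantCoeffSubalgebra

variable {k K : Type*} [CommRing k] [CommRing K] [Algebra k K]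

theorem mem_iff {f : K[X]} :
    f ∈ constantCoeffSubalgebra k K ↔ f.coeff 0 ∈ (⊥ : Subalgebra k K) := by
  rw [Polynomial.coeff_zero_eq_aeval_zero]
  rfl

theorem X_mul_mem (f : K[X]) : Polynomial.X * f ∈ constantCoeffSubalgebra k K :=
  mem_iff.2 (by simp)

theorem C_mul_X_mem (a : K) : Polynomial.C a * Polynomial.X ∈ constantCoeffSubalgebra k K :=
  mem_iff.2 (by simp)

theorem X_mem : Polynomial.X ∈ constantCoeffSubalgebra k K :=
  mem_iff.2 (by simp)

theorem eq_adjoin_of_span_eq_top {s : Set K} (hs : Submodule.span k s = ⊤) :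
    constantCoeffSubalgebra k K =
      Algebra.adjoin k ((fun a ↦ Polynomial.C a * Polynomial.X) '' s) := by
  refine le_antisymm (fun f hf ↦ ?_) (Algebra.adjoin_le ?_)
  · set P := Algebra.adjoin k ((fun a ↦ Polynomial.C a * Polynomial.X) '' s)
    have hCX (a : K) : Polynomial.C a * Polynomial.X ∈ P := by
      have ha : a ∈ Submodule.span k s := hs ▸ Submodule.mem_top
      induction ha using Submodule.span_induction with
      | mem a ha => exact Algebra.subset_adjoin ⟨a, ha, rfl⟩
      | zero => simp
      | add a b _ _ ha hb => simpa only [map_add, add_mul] using add_mem ha hb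
      | smul c a _ ha => simpa only [← Polynomial.smul_C, smul_mul_assoc] using P.smul_mem ha c
    have hX : Polynomial.X ∈ P := by simpa using hCX 1
    rw [f.as_sum_range_C_mul_X_pow]
    refine sum_mem fun n _ ↦ ?_
    cases n with
    | zero =>
      obtain ⟨c, hc⟩ := mem_iff.1 hf
      rw [← hc, pow_zero, mul_one]
      exact P.algebraMap_mem c
    | succ n =>
      rw [pow_succ', ← mul_assoc]
      exact mul_mem (hCX _) (pow_mem hX n)
  · rintro _ ⟨a, -, rfl⟩
    exact C_mul_X_mem a

theorem finiteType [Module.Finite k K] : Algebra.FiniteType k (constantCoeffSubalgebra k K) := by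
  obtain ⟨s, hs⟩ := Module.Finite.fg_top (R := k) (M := K)
  rw [eq_adjoin_of_span_eq_top hs, ← Subalgebra.fg_iff_finiteType]
  exact Subalgebra.fg_def.2 ⟨_, s.finite_toSet.image _, rfl⟩

theorem isNoetherianRing [IsNoetherianRing k] [Module.Finite k K] :
    IsNoetherianRing (constantCoeffSubalgebra k K) :=
  have := finiteType (k := k) (K := K)
  Algebra.FiniteType.isNoetherianRing k _

theorem isNoetherianRing_tensorProduct [Module.Finite k K] (A : Type*) [CommRing A] [Algebra k A]
    [IsNoetherianRing A] : IsNoetherianRing (A ⊗[k] constantCoeffSubalgebra k K) :=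
  have := finiteType (k := k) (K := K)
  Algebra.FiniteType.isNoetherianRing A _

theorem isFractionRing [IsDomain K] (L : Type*) [Field L] [Algebra K[X] L]
    [IsFractionRing K[X] L] : IsFractionRing (constantCoeffSubalgebra k K) L := by
  refine IsFractionRing.of_field _ L fun z ↦ ?_
  obtain ⟨a, b, -, rfl⟩ := IsFractionRing.div_surjective (A := K[X]) z
  refine ⟨⟨_, X_mul_mem a⟩, ⟨_, X_mul_mem b⟩, ?_⟩
  have hX : algebraMap K[X] L Polynomial.X ≠ 0 := by simp
  change _ = algebraMap K[X] L (Polynomial.X * a) / algebraMap K[X] L (Polynomial.X * b)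
  rw [map_mul, map_mul, mul_div_mul_left _ _ hX]

theorem isIntegral_polynomial [Algebra.IsIntegral k K] :
    Algebra.IsIntegral (constantCoeffSubalgebra k K) K[X] := by
  refine ⟨fun f ↦ ?_⟩
  have hC (a : K) : IsIntegral (constantCoeffSubalgebra k K) (Polynomial.C a) :=
    ((Algebra.IsIntegral.isIntegral (R := k) a).map
      (Polynomial.CAlgHom (R := k) (A := K))).tower_top
  have hX : IsIntegral (constantCoeffSubalgebra k K) (Polynomial.X : K[X]) :=
    isIntegral_algebraMap (x := (⟨_, X_mem⟩ : constantCoeffSubalgebra k K))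
  induction f using Polynomial.induction_on with
  | C a => exact hC a
  | add f g hf hg => exact hf.add hg
  | monomial n a _ => exact (hC a).mul (hX.pow _)

theorem finite_polynomial [Module.Finite k K] :
    Module.Finite (constantCoeffSubalgebra k K) K[X] := by
  have := isIntegral_polynomial (k := k) (K := K)
  have : Algebra.FiniteType k K[X] := .trans (S := K) inferInstance inferInstance
  have : Algebra.FiniteType (constantCoeffSubalgebra k K) K[X] :=
    .of_restrictScalars_finiteType k _ _
  exact Algebra.IsIntegral.finite

variable (k K) in
/-- For an integral extension `K` of `k` that is a normal domain, `K[X]` is the integral closure of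
`k + X K[X]` in its field of fractions. -/
noncomputable def totalIntegralClosureEquivPolynomial [IsDomain K] [IsIntegrallyClosed K]
    [Algebra.IsIntegral k K] :
    totalIntegralClosure (constantCoeffSubalgebra k K) ≃ₐ[constantCoeffSubalgebra k K] K[X] :=
  haveI := isIntegral_polynomial (k := k) (K := K)
  haveI := isFractionRing (k := k) (K := K) (FractionRing K[X])
  haveI := IsIntegralClosure.of_isIntegrallyClosed K[X] (constantCoeffSubalgebra k K)
    (FractionRing K[X])
  totalIntegralClosureEquiv (constantCoeffSubalgebra k K) K[X] (FractionRing K[X])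

theorem isStrictlyClosedIn_polynomial (h : IsStrictlyClosedIn k K) :
    IsStrictlyClosedIn (constantCoeffSubalgebra k K) K[X] := by
  refine eq_bot_iff.2 fun f hf ↦ ?_
  have hf0 : f.coeff 0 ∈ (⊥ : Subalgebra k K) :=
    h ▸ map_mem_strictClosure Polynomial.constantCoeff (fun r ↦ mem_iff.1 r.2) hf
  exact ⟨⟨f, mem_iff.2 hf0⟩, rfl⟩

theorem isStrictlyClosed [IsDomain K] [IsIntegrallyClosed K] [Algebra.IsIntegral k K]
    (h : IsStrictlyClosedIn k K) : IsStrictlyClosed (constantCoeffSubalgebra k K) :=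
  (isStrictlyClosedIn_polynomial h).of_algEquiv (totalIntegralClosureEquivPolynomial k K)

theorem finite_totalIntegralClosure [IsDomain K] [IsIntegrallyClosed K] [Module.Finite k K] :
    Module.Finite (constantCoeffSubalgebra k K)
      (totalIntegralClosure (constantCoeffSubalgebra k K)) :=
  have := finite_polynomial (k := k) (K := K)
  .equiv (totalIntegralClosureEquivPolynomial k K).symm.toLinearEquiv

theorem sq_mem_bot_of_isNilpotent (h : IsStrictlyClosed (constantCoeffSubalgebra k K)) {a : K}
    (ha : IsNilpotent a) : a ^ 2 ∈ (⊥ : Subalgebra k K) := by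
  let x : constantCoeffSubalgebra k K := ⟨_, pow_mem X_mem 2⟩
  let y : constantCoeffSubalgebra k K := ⟨_, C_mul_X_mem a⟩
  have hx : x ∈ nonZeroDivisors (constantCoeffSubalgebra k K) := by
    refine mem_nonZeroDivisors_of_injective (f := (constantCoeffSubalgebra k K).val)
      Subtype.val_injective ?_
    exact (Polynomial.monic_X_pow 2).mem_nonZeroDivisors
  have hy : IsNilpotent y := by
    rw [← IsNilpotent.map_iff (f := (constantCoeffSubalgebra k K).val) Subtype.val_injective]
    exact (Commute.all _ _).isNilpotent_mul_right (ha.map Polynomial.C)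
  obtain ⟨s, hs⟩ := h.dvd_sq_of_isNilpotent hx hy
  have hs' : (Polynomial.C a * Polynomial.X) ^ 2 = Polynomial.X ^ 2 * (s : K[X]) :=
    congrArg Subtype.val hs
  have hcoeff : a ^ 2 = (s : K[X]).coeff 0 := by
    simpa [mul_pow, ← map_pow, Polynomial.coeff_X_pow_mul'] using
      congrArg (Polynomial.coeff · 2) hs'
  rw [hcoeff]
  exact mem_iff.1 s.2

section BaseChange

variable (k K) (A : Type*) [CommRing A] [Algebra k A]

/-- The canonical homomorphism from `A ⊗ (k + X K[X])` to `(A ⊗ K)[X]`. -/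
noncomputable def baseChangeHom :
    A ⊗[k] constantCoeffSubalgebra k K →ₐ[A] (A ⊗[k] K)[X] :=
  (polynomialBaseChangeEquiv k A K).toAlgHom.comp
    (Algebra.TensorProduct.map (.id A A) (constantCoeffSubalgebra k K).val)

variable {k K A} in
@[simp]
theorem baseChangeHom_tmul (a : A) (f : constantCoeffSubalgebra k K) :
    baseChangeHom k K A (a ⊗ₜ f) =
      Polynomial.C (a ⊗ₜ 1) * (f : K[X]).map Algebra.TensorProduct.includeRight.toRingHom :=
  rfl

theorem baseChangeHom_injective [Module.Flat k A] :
    Function.Injective (baseChangeHom k K A) :=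
  (polynomialBaseChangeEquiv k A K).injective.comp
    (Module.Flat.lTensor_preserves_injective_linearMap (M := A)
      (constantCoeffSubalgebra k K).val.toLinearMap Subtype.val_injective)

theorem range_baseChangeHom :
    (baseChangeHom k K A).range = constantCoeffSubalgebra A (A ⊗[k] K) := by
  apply le_antisymm
  · rintro _ ⟨s, rfl⟩
    induction s with
    | zero => exact map_zero (baseChangeHom k K A) ▸ zero_mem _
    | tmul a r =>
      obtain ⟨c, hc⟩ := Algebra.mem_bot.1 (mem_iff.1 r.2)
      refine mem_iff.2 ⟨c • a, ?_⟩
      calc (c • a) ⊗ₜ[k] (1 : K) = a ⊗ₜ (r : K[X]).coeff 0 := by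
            rw [← hc, Algebra.algebraMap_eq_smul_one, TensorProduct.smul_tmul]
        _ = (baseChangeHom k K A (a ⊗ₜ r)).coeff 0 := by simp
    | add s t hs ht => exact map_add (baseChangeHom k K A) s t ▸ add_mem hs ht
  · have hspan : Submodule.span A (Set.range (1 ⊗ₜ[k] · : K → A ⊗[k] K)) = ⊤ := by
      rw [← Submodule.baseChange_top, Submodule.baseChange_eq_span, Submodule.map_top]
      rfl
    rw [eq_adjoin_of_span_eq_top hspan]
    refine Algebra.adjoin_le ?_
    rintro _ ⟨_, ⟨b, rfl⟩, rfl⟩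
    refine ⟨1 ⊗ₜ ⟨_, C_mul_X_mem b⟩, ?_⟩
    simp [← Algebra.TensorProduct.one_def]

/-- Over a flat `k`-algebra `A`, the base change of `k + X K[X]` is `A + X (A ⊗ K)[X]`. -/
noncomputable def baseChangeEquiv [Module.Flat k A] :
    A ⊗[k] constantCoeffSubalgebra k K ≃ₐ[A] constantCoeffSubalgebra A (A ⊗[k] K) :=
  (AlgEquiv.ofInjective _ (baseChangeHom_injective k K A)).trans
    (Subalgebra.equivOfEq _ _ (range_baseChangeHom k K A))

end BaseChange

end constantCoeffSubalgebra

end ConstantCoeff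

section PurelyInseparable

variable {k K : Type*} [Field k] [Field K] [Algebra k K]

theorem isNilpotent_one_tmul_sub_tmul_one (p : ℕ) [ExpChar k p] {n : ℕ} {t : K}
    (ht : t ^ p ^ n ∈ (⊥ : Subalgebra k K)) :
    IsNilpotent ((1 : K) ⊗ₜ[k] t - t ⊗ₜ[k] (1 : K)) := by
  have : ExpChar (K ⊗[k] K) p := expChar_of_injective_algebraMap (algebraMap k _).injective p
  obtain ⟨c, hc⟩ := Algebra.mem_bot.1 ht
  refine ⟨p ^ n, ?_⟩
  rw [sub_pow_expChar_pow, Algebra.TensorProduct.tmul_pow, Algebra.TensorProduct.tmul_pow,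
    one_pow, sub_eq_zero, ← hc, Algebra.TensorProduct.tmul_one_eq_one_tmul]

theorem sq_one_tmul_sub_tmul_one_notMem_bot {t : K}
    (ht : LinearIndependent k fun i : Fin 3 ↦ t ^ (i : ℕ)) :
    ((1 : K) ⊗ₜ[k] t - t ⊗ₜ[k] (1 : K)) ^ 2 ∉ (⊥ : Subalgebra K (K ⊗[k] K)) := by
  rintro ⟨a, ha⟩
  have hli := Fintype.linearIndependent_iff.1 (Module.Flat.linearIndependent_one_tmul (S := K) ht)
  have hsum : ∑ i : Fin 3, ![t ^ 2 - a, -2 * t, 1] i • (1 : K) ⊗ₜ[k] (t ^ (i : ℕ)) = 0 := by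
    have ha' : a ⊗ₜ[k] (1 : K) = ((1 : K) ⊗ₜ[k] t - t ⊗ₜ[k] (1 : K)) ^ 2 := ha
    have hsq : ((1 : K) ⊗ₜ[k] t - t ⊗ₜ[k] (1 : K)) ^ 2 =
        (1 : K) ⊗ₜ[k] (t ^ 2) - 2 * (t ⊗ₜ[k] t) + (t ^ 2) ⊗ₜ[k] (1 : K) := by
      rw [sub_sq]
      simp [mul_assoc]
    simp only [Fin.sum_univ_three, Matrix.cons_val, TensorProduct.smul_tmul', smul_eq_mul,
      Fin.val_zero, Fin.val_one, Fin.val_two, pow_zero, pow_one, mul_one, TensorProduct.sub_tmul,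
      ha', hsq]
    rw [neg_mul, TensorProduct.neg_tmul, two_mul t, TensorProduct.add_tmul]
    ring
  simpa using hli _ hsum 2

theorem not_isStrictlyClosed_tensorProduct (p : ℕ) [ExpChar k p] {n : ℕ} {t : K}
    (htp : t ^ p ^ n ∈ (⊥ : Subalgebra k K))
    (ht : LinearIndependent k fun i : Fin 3 ↦ t ^ (i : ℕ)) :
    ¬ IsStrictlyClosed (K ⊗[k] constantCoeffSubalgebra k K) := fun h ↦
  sq_one_tmul_sub_tmul_one_notMem_bot ht <|
    constantCoeffSubalgebra.sq_mem_bot_of_isNilpotent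
      (h.of_ringEquiv (constantCoeffSubalgebra.baseChangeEquiv k K K).symm.toRingEquiv)
      (isNilpotent_one_tmul_sub_tmul_one p htp)

end PurelyInseparable

section RatFunc

variable (F : Type*) [Field F]

theorem finrank_adjoin_ratFuncX_pow (n : ℕ) :
    Module.finrank (IntermediateField.adjoin F {(RatFunc.X : RatFunc F) ^ n}) (RatFunc F) = n := by
  have h : (RatFunc.X : RatFunc F) ^ n = algebraMap F[X] (RatFunc F) (Polynomial.X ^ n) := by simp
  rw [RatFunc.finrank_eq_max_natDegree, h, RatFunc.num_algebraMap, RatFunc.denom_algebraMap,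
    Polynomial.natDegree_X_pow, Polynomial.natDegree_one, max_eq_left n.zero_le]

theorem finite_adjoin_ratFuncX_pow (n : ℕ) [NeZero n] :
    Module.Finite (IntermediateField.adjoin F {(RatFunc.X : RatFunc F) ^ n}) (RatFunc F) :=
  Module.finite_of_finrank_pos ((finrank_adjoin_ratFuncX_pow F n).symm ▸ Nat.pos_of_neZero n)

theorem algebraAdjoin_ratFuncX_eq_top (E : IntermediateField F (RatFunc F))
    [Algebra.IsIntegral E (RatFunc F)] : Algebra.adjoin E {(RatFunc.X : RatFunc F)} = ⊤ := by
  rw [← IntermediateField.adjoin_simple_toSubalgebra_of_isAlgebraic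
    (Algebra.IsIntegral.isIntegral _).isAlgebraic, RatFunc.IntermediateField.adjoin_X,
    IntermediateField.top_toSubalgebra]

theorem exists_basis_eq_ratFuncX_pow (n : ℕ) [NeZero n] :
    ∃ b : Module.Basis (Fin n) (IntermediateField.adjoin F {(RatFunc.X : RatFunc F) ^ n})
      (RatFunc F), ∀ i : Fin n, b i = RatFunc.X ^ (i : ℕ) := by
  have := finite_adjoin_ratFuncX_pow F n
  let pb := PowerBasis.ofAdjoinEqTop (Algebra.IsIntegral.isIntegral RatFunc.X)
    (algebraAdjoin_ratFuncX_eq_top F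
      (IntermediateField.adjoin F {(RatFunc.X : RatFunc F) ^ n}))
  have hgen : pb.gen = RatFunc.X := PowerBasis.ofAdjoinEqTop_gen _ _
  have hdim : pb.dim = n := pb.finrank.symm.trans (finrank_adjoin_ratFuncX_pow F n)
  exact ⟨pb.basis.reindex (finCongr hdim), fun i ↦ by
    rw [Module.Basis.reindex_apply, pb.basis_eq_pow, hgen]
    rfl⟩

theorem cubeRing_eq_constantCoeffSubalgebra :
    cubeRing F = constantCoeffSubalgebra (cubeSubfield F) (RatFunc F) := by
  obtain ⟨b, hb⟩ := exists_basis_eq_ratFuncX_pow F 3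
  have hb' : Set.range b = {1, RatFunc.X, RatFunc.X ^ 2} := by
    rw [funext hb]
    ext
    simp [Fin.exists_fin_succ, eq_comm]
  rw [constantCoeffSubalgebra.eq_adjoin_of_span_eq_top b.span_eq, hb', cubeRing]
  simp [Set.image_insert_eq]

end RatFunc

theorem mainTheorem8 (F : Type u) [Field F] [CharP F 3] :
    -- `K = k[t]`, and `1, t, t²` is a `k`-basis of `K`
    (Algebra.adjoin (cubeSubfield F) {(RatFunc.X : RatFunc F)} = ⊤ ∧
      ∃ b : Module.Basis (Fin 3) (cubeSubfield F) (RatFunc F),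
        ∀ i : Fin 3, b i = (RatFunc.X : RatFunc F) ^ (i : ℕ)) ∧
    -- `R` is strictly closed, but `K ⊗[k] R` is not
    (IsStrictlyClosed (cubeRing F) ∧
      ¬ IsStrictlyClosed (RatFunc F ⊗[cubeSubfield F] cubeRing F)) ∧
    -- `R → K ⊗[k] R` is a faithfully flat homomorphism of Noetherian rings, `R` is reduced, and
    -- the integral closure of `R` is a finite `R`-module
    (IsNoetherianRing (cubeRing F) ∧
      IsNoetherianRing (RatFunc F ⊗[cubeSubfield F] cubeRing F) ∧
      (Algebra.TensorProduct.includeRight :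
        cubeRing F →ₐ[cubeSubfield F]
          RatFunc F ⊗[cubeSubfield F] cubeRing F).toRingHom.FaithfullyFlat ∧
      IsReduced (cubeRing F) ∧
      Module.Finite (cubeRing F) (totalIntegralClosure (cubeRing F))) := by
  have := finite_adjoin_ratFuncX_pow F 3
  obtain ⟨b, hb⟩ := exists_basis_eq_ratFuncX_pow F 3
  have hcube : (RatFunc.X : RatFunc F) ^ 3 ^ 1 ∈ (⊥ : Subalgebra (cubeSubfield F) (RatFunc F)) :=
    ⟨⟨RatFunc.X ^ 3, IntermediateField.mem_adjoin_simple_self _ _⟩, rfl⟩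
  have : CharP (cubeSubfield F) 3 := charP_of_injective_algebraMap (algebraMap F _).injective 3
  rw [cubeRing_eq_constantCoeffSubalgebra F]
  exact ⟨⟨algebraAdjoin_ratFuncX_eq_top F _, b, hb⟩,
    ⟨constantCoeffSubalgebra.isStrictlyClosed .of_faithfullyFlat,
      not_isStrictlyClosed_tensorProduct 3 hcube (funext hb ▸ b.linearIndependent)⟩,
    constantCoeffSubalgebra.isNoetherianRing,
    constantCoeffSubalgebra.isNoetherianRing_tensorProduct _,
    faithfullyFlat_includeRight, inferInstance,
    constantCoeffSubalgebra.finite_totalIntegralClosure⟩
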